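/- Let $\mathbb{C}[\vec{x}^{\pm1}]$ be the ring of Laurent polynomials in $x_1,x_2,x_3$; for $f=\sum_{\vec u} f_{\vec u}\vec{x}^{\vec u}$ let $\mathrm{Supp}(f)=\{\vec u\in\mathbb{Z}^3 : f_{\vec u}\neq 0\}$. Let $D=B_2^3=\{(n_1,n_2,n_3)\in\mathbb{Z}^3 : |n_1|+|n_2|+|n_3|\le 2\}$ be the radius-$2$ Lee sphere and $f_D(\vec{x})=\sum_{\vec u\in D}\vec{x}^{\vec u}$. For a linear subspace $S\subseteq\mathbb{R}^3$, an $S$-fiber is a Laurent polynomial $f$ with $\mathrm{Supp}(f)\subseteq S$; the $S$-fibers form a subring of $\mathbb{C}[\vec{x}^{\pm1}]$. The $S$-fibers of a Laurent polynomial $f$ are the polynomials $(\vec{x}^{\vec u}f)\restriction S$, $\vec u\in\mathbb{Z}^3$, where $g\restriction S=\sum_{\vec v\in \mathrm{Supp}(g)\cap S}g_{\vec v}\vec{x}^{\vec v}$. A configuration is a map $c:\mathbb{Z}^3\to\mathbb{Z}$ with finitely many values, identified with the formal power series $\sum_{\vec u} c_{\vec u}\vec{x}^{\vec u}$, so that $(fc)_{\vec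 u}=\sum_{\vec v\in\mathrm{Supp}(f)}f_{\vec v}c_{\vec u-\vec v}$ for a Laurent polynomial $f$. A function $e$ on $\mathbb{Z}^3$ is strongly periodic if there are three vectors $\vec t\in\mathbb{Z}^3$, linearly independent over $\mathbb{R}$, with $e_{\vec u+\vec t}=e_{\vec u}$ for all $\vec u\in\mathbb{Z}^3$. The polynomial $f$ is a periodizer of $c$ if $fc$ is strongly periodic. Then: 1. for every plane (two-dimensional linear subspace) $S\subseteq\mathbb{R}^3$, the $S$-fibers of $f_D$ generate a non-zero monomial, that is, the ideal they generate in the ring of $S$-fibers contains $a\,\vec{x}^{\vec v}$ for some $a\in\mathbb{C}\setminus\{0\}$ and $\vec v\in\mathbb{Z}^3$; 2. every configuration $c$ that has $f_D$ as a periodizer is strongly periodic; 3. in particular, every tiling of $\mathbb{Z}^3$ by $D$, i.e. every $c:\mathbb{Z}^3\to\{0,1\}$ such that all coefficients of $f_Dc$ are $1$, is strongly periodic. -/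

import Mathlib

noncomputable section

/-- Cells of the `d`-dimensional infinite grid `ℤ^d`. -/
abbrev Cell (d : ℕ) : Type := Fin d → ℤ

/-- A cell viewed as a vector of the real vector space `ℝ^d`. -/
def Cell.toReal {d : ℕ} (v : Cell d) : Fin d → ℝ := fun i => (v i : ℝ)

/-- Laurent polynomials over `ℂ` in `d` variables: finite formal linear combinations of the
monomials `x^u`, `u ∈ ℤ^d`, with `x^u * x^v = x^(u+v)`. -/
abbrev LaurentPoly (d : ℕ) : Type := AddMonoidAlgebra ℂ (Cell d)

/-- The monomial `a x^u`. -/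
def laurentMonomial {d : ℕ} (u : Cell d) (a : ℂ) : LaurentPoly d := AddMonoidAlgebra.single u a

/-- `Supp(f)`, the set of cells with a non-zero coefficient. -/
def laurentSupp {d : ℕ} (f : LaurentPoly d) : Finset (Cell d) := f.coeff.support

/-- The characteristic polynomial `f_D = ∑_{u ∈ D} x^u` of a finite shape `D`. -/
def charPoly {d : ℕ} (D : Finset (Cell d)) : LaurentPoly d :=
  ∑ u ∈ D, laurentMonomial u 1

/-- The radius-`r` Lee sphere `B_r^d`, as a finite set; see `mem_leeSphere`. -/
def leeSphere (r d : ℕ) : Finset (Cell d) :=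
  (Fintype.piFinset fun _ : Fin d => Finset.Icc (-(r : ℤ)) (r : ℤ)).filter
    fun n => ∑ i, |n i| ≤ (r : ℤ)

/-- `B_r^d` is the set of all `n ∈ ℤ^d` with `∑ |n_i| ≤ r`. -/
theorem mem_leeSphere {r d : ℕ} (n : Cell d) :
    n ∈ leeSphere r d ↔ ∑ i, |n i| ≤ (r : ℤ) := by
  unfold leeSphere
  rw [Finset.mem_filter, Fintype.mem_piFinset]
  refine ⟨fun h => h.2, fun h => ⟨fun i => ?_, h⟩⟩
  rw [Finset.mem_Icc, ← abs_le]
  exact (Finset.single_le_sum (f := fun i => |n i|) (fun j _ => abs_nonneg _)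
    (Finset.mem_univ i)).trans h

/-! ### Fibers -/

/-- A Laurent polynomial is an `S`-fiber if its support is contained in `S`. -/
def IsFiber {d : ℕ} (S : Submodule ℝ (Fin d → ℝ)) (f : LaurentPoly d) : Prop :=
  ∀ v ∈ laurentSupp f, v.toReal ∈ S

/-- The ring of all `S`-fibers, a subring of the Laurent polynomial ring. -/
def fiberRing {d : ℕ} (S : Submodule ℝ (Fin d → ℝ)) : Subring (LaurentPoly d) where
  carrier := {f | IsFiber S f}
  zero_mem' := by
    intro v hv
    simp [laurentSupp] at hv
  one_mem' := by
    classical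
    intro v hv
    have h := AddMonoidAlgebra.support_coeff_one_subset hv
    rw [Finset.mem_zero] at h
    subst h
    have h0 : (0 : Cell d).toReal = 0 := by
      funext i
      simp [Cell.toReal]
    rw [h0]
    exact S.zero_mem
  add_mem' := by
    classical
    intro f g hf hg v hv
    have h := Finsupp.support_add hv
    rcases Finset.mem_union.1 h with h | h
    · exact hf v h
    · exact hg v h
  neg_mem' := by
    intro f hf v hv
    refine hf v ?_
    simpa [laurentSupp] using hv
  mul_mem' := by
    classical
    intro f g hf hg v hv
    have h := AddMonoidAlgebra.support_coeff_mul_subset f g hv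
    obtain ⟨a, ha, b, hb, rfl⟩ := Finset.mem_add.1 h
    have hab : (a + b).toReal = a.toReal + b.toReal := by
      funext i
      simp [Cell.toReal]
    rw [hab]
    exact S.add_mem (hf a ha) (hg b hb)

open Classical in
/-- The restriction `f ↾ S`: the sum of the terms of `f` whose exponents lie in `S`. -/
def restrictPoly {d : ℕ} (S : Submodule ℝ (Fin d → ℝ)) (f : LaurentPoly d) : LaurentPoly d :=
  ∑ u ∈ (laurentSupp f).filter (fun u => u.toReal ∈ S), laurentMonomial u (f.coeff u)

/-- The `S`-fibers of a single polynomial `f`: the restrictions `(x^u f) ↾ S` over all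
`u ∈ ℤ^d`, as elements of the ring of `S`-fibers. -/
def fibersOf {d : ℕ} (S : Submodule ℝ (Fin d → ℝ)) (f : LaurentPoly d) : Set (fiberRing S) :=
  {g | ∃ u : Cell d, (g : LaurentPoly d) = restrictPoly S (laurentMonomial u 1 * f)}

/-- The `S`-fibers of `f` generate a non-zero monomial: the ideal that they generate in the ring of
`S`-fibers contains some `a x^v` with `a ≠ 0`. -/
def FibersGenerateMonomial {d : ℕ} (S : Submodule ℝ (Fin d → ℝ)) (f : LaurentPoly d) : Prop :=
  ∃ g ∈ Ideal.span (fibersOf S f), ∃ (v : Cell d) (a : ℂ),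
    a ≠ 0 ∧ (g : LaurentPoly d) = laurentMonomial v a

/-! ### Configurations, periodicity and periodizers -/

/-- A configuration: an assignment of integers to the cells that takes only finitely many
values. -/
def IsConfiguration {d : ℕ} (c : Cell d → ℤ) : Prop := (Set.range c).Finite

/-- `t` is a vector of periodicity of `c` (possibly zero). -/
def IsPeriod {d : ℕ} {A : Type*} (c : Cell d → A) (t : Cell d) : Prop :=
  ∀ u, c (u + t) = c u

/-- `c` has `d` vectors of periodicity that are linearly independent in `ℝ^d`. -/
def StronglyPeriodic {d : ℕ} {A : Type*} (c : Cell d → A) : Prop :=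
  ∃ t : Fin d → Cell d,
    LinearIndependent ℝ (fun i => (t i).toReal) ∧ ∀ i, IsPeriod c (t i)

/-- The product `f c` of a Laurent polynomial `f` and the formal power series `∑ c_u x^u`, as the
family of its coefficients: `(f c)_u = ∑_{v ∈ Supp f} f_v c_{u-v}`. -/
def polyMul {d : ℕ} (f : LaurentPoly d) (c : Cell d → ℤ) : Cell d → ℂ :=
  fun u => ∑ v ∈ laurentSupp f, f.coeff v * (c (u - v) : ℂ)

/-- The set `Per(c)` of periodizers of `c`. -/
def periodizers {d : ℕ} (c : Cell d → ℤ) : Set (LaurentPoly d) :=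
  {f | StronglyPeriodic (polyMul f c)}

/-- `c` is a tiling by the tile `D`: it is binary and `c f_D` is the uniform configuration of
ones. -/
def IsTiling {d : ℕ} (D : Finset (Cell d)) (c : Cell d → ℤ) : Prop :=
  (∀ u, c u = 0 ∨ c u = 1) ∧ polyMul (charPoly D) c = fun _ => 1

end

/-! Periodicity: let `f_D` annihilate a finitely valued integer function `g`. Modulo a prime `p`,
`f_D(x)^p = f_D(x^p)`, and for `p` large against the values of `g` a coefficient divisible by `p` is
zero. Hence `f_D(x^k)` annihilates `g` for every `k = 1 + r j`, with `r` a suitable factorial.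
Modulo a prime ideal `P` containing the annihilator this reads `∑ x^u (x^(ru))^j = 0` for all `j`,
so by a Vandermonde argument the sum of `x^u` over each class of `u ∈ D` with equal `x^(ru)`
vanishes. If the differences within classes did not span, they would lie in a hyperplane `S`; every
`S`-fiber of `f_D` would be, up to a monomial factor, a sum over whole classes, hence in `P`,
although the fibers generate a unit (`span_unitExponents_eq_top`). So they span, `x^(rNt) - 1` lies
in all such `P` with one common `N`, and some power of it annihilates `g`; since `g` is bounded,
`rNt` is a period. A periodized `c` is reduced to this case through its differences `c(u + t) -
c(u)`.

Fibers: restriction to `S` is linear over the ring of `S`-fibers, so it suffices that no maximal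
ideal of the full ring contains all fibers. One that does gives nonzero `z_i` in a field of
characteristic zero for which the monomials of the Lee sphere sum to zero on each level set of a
linear form. Up to symmetry the form is nonnegative and sorted, and a few levels give a
contradiction (`not_vanishesOnLevels_of_sorted`). -/

noncomputable section

/-! ### The shift action of Laurent polynomials on functions -/

section ShiftAction

variable {d : ℕ} {R : Type*} [CommRing R]

/-- The shift of functions on `ℤ^d` by `v`. -/
def shiftHom (d : ℕ) (R : Type*) [CommRing R] :
    Multiplicative (Cell d) →* Module.End R (Cell d → R) where
  toFun v := LinearMap.funLeft R R fun u => u - v.toAdd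
  map_one' := by
    ext c u
    simp [LinearMap.funLeft]
  map_mul' v w := by
    ext c u
    simp [LinearMap.funLeft, sub_sub]

/-- The action of Laurent polynomials on functions on `ℤ^d` by convolution. -/
def shiftAct (d : ℕ) (R : Type*) [CommRing R] :
    AddMonoidAlgebra R (Cell d) →ₐ[R] Module.End R (Cell d → R) :=
  AddMonoidAlgebra.lift R (Module.End R (Cell d → R)) (Cell d) (shiftHom d R)

theorem shiftAct_single (v : Cell d) (a : R) (c : Cell d → R) (u : Cell d) :
    shiftAct d R (AddMonoidAlgebra.single v a) c u = a * c (u - v) := by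
  rw [shiftAct, AddMonoidAlgebra.lift_single]
  simp [shiftHom, LinearMap.funLeft]

theorem shiftAct_sum_single {ι : Type*} (s : Finset ι) (v : ι → Cell d) (c : Cell d → R)
    (u : Cell d) :
    shiftAct d R (∑ i ∈ s, AddMonoidAlgebra.single (v i) 1) c u = ∑ i ∈ s, c (u - v i) := by
  rw [map_sum, LinearMap.sum_apply, Finset.sum_apply]
  exact Finset.sum_congr rfl fun i _ => by rw [shiftAct_single, one_mul]

theorem polyMul_eq_shiftAct (f : LaurentPoly d) (c : Cell d → ℤ) :
    polyMul f c = shiftAct d ℂ f fun u => (c u : ℂ) := by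
  funext u
  rw [shiftAct, AddMonoidAlgebra.lift_apply, Finsupp.sum, LinearMap.sum_apply, Finset.sum_apply]
  exact Finset.sum_congr rfl fun v _ => by simp [shiftHom, LinearMap.funLeft]

/-- The ideal of Laurent polynomials that annihilate a function. -/
def annihilatorIdeal (c : Cell d → ℂ) : Ideal (LaurentPoly d) where
  carrier := {f | shiftAct d ℂ f c = 0}
  zero_mem' := by simp
  add_mem' := by
    intro f g hf hg
    simp only [Set.mem_ofPred_eq] at hf hg ⊢
    rw [map_add, LinearMap.add_apply, hf, hg, add_zero]
  smul_mem' := by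
    intro g f hf
    simp only [Set.mem_ofPred_eq] at hf ⊢
    rw [smul_eq_mul, map_mul, Module.End.mul_apply, hf, map_zero]

theorem mem_annihilatorIdeal {c : Cell d → ℂ} {f : LaurentPoly d} :
    f ∈ annihilatorIdeal c ↔ shiftAct d ℂ f c = 0 := Iff.rfl

end ShiftAction

/-! ### Dilations of an annihilator -/

section Dilation

variable {d : ℕ}

theorem sum_dilate_prime_eq_zero {D : Finset (Cell d)} {c : Cell d → ℤ} {M p k : ℕ}
    (hM : ∀ u, |c u| ≤ M) (hp : p.Prime) (hpM : D.card * M < p)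
    (h : ∀ w, ∑ u ∈ D, c (w - (k : ℤ) • u) = 0) (w : Cell d) :
    ∑ u ∈ D, c (w - ((p * k : ℕ) : ℤ) • u) = 0 := by
  have : Fact p.Prime := ⟨hp⟩
  have hchar : CharP (AddMonoidAlgebra (ZMod p) (Cell d)) p := by
    refine charP_of_injective_ringHom (f := AddMonoidAlgebra.singleZeroRingHom) ?_ p
    exact AddMonoidAlgebra.single_right_injective
  -- Frobenius in characteristic `p`: the `p`-th power only dilates the exponents.
  have hf : (∑ u ∈ D, AddMonoidAlgebra.single ((k : ℤ) • u) (1 : ZMod p)) ^ p =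
      ∑ u ∈ D, AddMonoidAlgebra.single (((p * k : ℕ) : ℤ) • u) (1 : ZMod p) := by
    rw [sum_pow_char]
    refine Finset.sum_congr rfl fun u _ => ?_
    rw [AddMonoidAlgebra.single_pow, one_pow, Nat.cast_mul, mul_smul, natCast_zsmul _ p]
  have h0 : shiftAct d (ZMod p) (∑ u ∈ D, AddMonoidAlgebra.single ((k : ℤ) • u) (1 : ZMod p))
      (fun u => (c u : ZMod p)) = 0 := by
    funext u
    rw [shiftAct_sum_single, Pi.zero_apply]
    exact_mod_cast congrArg (Int.cast : ℤ → ZMod p) (h u)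
  have h1 : ((∑ u ∈ D, c (w - ((p * k : ℕ) : ℤ) • u) : ℤ) : ZMod p) = 0 := by
    have h2 := congrFun (congrArg (fun T => T fun u => (c u : ZMod p))
      (congrArg (shiftAct d (ZMod p)) hf)) w
    rw [shiftAct_sum_single, ← pow_sub_one_mul hp.ne_zero, map_mul,
      Module.End.mul_apply, h0, map_zero] at h2
    rw [Int.cast_sum, ← h2, Pi.zero_apply]
  rw [ZMod.intCast_zmod_eq_zero_iff_dvd] at h1
  refine Int.eq_zero_of_abs_lt_dvd h1 ?_
  calc |∑ u ∈ D, c (w - ((p * k : ℕ) : ℤ) • u)|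
      ≤ ∑ u ∈ D, |c (w - ((p * k : ℕ) : ℤ) • u)| := Finset.abs_sum_le_sum_abs _ _
    _ ≤ ∑ _u ∈ D, (M : ℤ) := Finset.sum_le_sum fun _ _ => hM _
    _ < p := by
      rw [Finset.sum_const, nsmul_eq_mul]
      exact_mod_cast hpM

theorem sum_dilate_eq_zero {D : Finset (Cell d)} {c : Cell d → ℤ} {M : ℕ}
    (hM : ∀ u, |c u| ≤ M) (h : ∀ w, ∑ u ∈ D, c (w - u) = 0) (k : ℕ) (hk : k ≠ 0)
    (hkM : ∀ p, p.Prime → p ∣ k → D.card * M < p) (w : Cell d) :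
    ∑ u ∈ D, c (w - (k : ℤ) • u) = 0 := by
  induction k using induction_on_primes generalizing w with
  | zero => exact absurd rfl hk
  | one => simpa using h w
  | prime_mul p a hp ih =>
    exact sum_dilate_prime_eq_zero hM hp (hkM p hp (dvd_mul_right p a))
      (ih (right_ne_zero_of_mul hk) fun q hq hqa => hkM q hq (hqa.mul_left p)) w

theorem IsConfiguration.exists_abs_le {c : Cell d → ℤ} (hc : IsConfiguration c) :
    ∃ M : ℕ, ∀ u, |c u| ≤ M := by
  obtain ⟨B, hB⟩ := (hc.image fun x => x.natAbs).bddAbove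
  refine ⟨B, fun u => ?_⟩
  have h := hB ⟨c u, ⟨u, rfl⟩, rfl⟩
  rw [Int.abs_eq_natAbs]
  exact_mod_cast h

/-- A finitely valued integer function annihilated by `f_D` is annihilated by the dilations of
`f_D` by the factors in an arithmetic progression. -/
theorem IsConfiguration.exists_dilate_mem_annihilatorIdeal {D : Finset (Cell d)} {c : Cell d → ℤ}
    (hc : IsConfiguration c) (h : ∀ w, ∑ u ∈ D, c (w - u) = 0) :
    ∃ r : ℕ, 0 < r ∧ ∀ j : ℕ,
      (∑ u ∈ D, laurentMonomial (((1 + r * j : ℕ) : ℤ) • u) 1) ∈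
        annihilatorIdeal fun u => (c u : ℂ) := by
  obtain ⟨M, hM⟩ := hc.exists_abs_le
  -- Every prime up to `|D| M` divides the factorial, so none divides `1 + r j`.
  refine ⟨(D.card * M).factorial, Nat.factorial_pos _, fun j => ?_⟩
  rw [mem_annihilatorIdeal]
  funext w
  unfold laurentMonomial
  rw [shiftAct_sum_single, Pi.zero_apply]
  refine mod_cast congrArg (Int.cast : ℤ → ℂ)
    (sum_dilate_eq_zero hM h (1 + (D.card * M).factorial * j) (by omega) (fun p hp hpk => ?_) w)
  by_contra! hle
  have h1 : p ∣ (D.card * M).factorial * j := (hp.dvd_factorial.2 hle).mul_right j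
  exact hp.one_lt.ne' (Nat.dvd_one.1 ((Nat.dvd_add_left h1).1 hpk))

end Dilation

/-! ### Bounded functions and iterated differences -/

section Differences

variable {d : ℕ}

theorem IsPeriod.nsmul {A : Type*} {c : Cell d → A} {t : Cell d} (h : IsPeriod c t) (n : ℕ) :
    IsPeriod c (n • t) := by
  induction n with
  | zero => intro u; rw [zero_smul, add_zero]
  | succ n ih => intro u; rw [succ_nsmul, ← add_assoc, h, ih]

/-- A bounded function with periodic differences along `t` has period `t`. -/
theorem isPeriod_of_isPeriod_sub {g : Cell d → ℂ} {t : Cell d} {M : ℝ} (hM : ∀ u, ‖g u‖ ≤ M)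
    (h : IsPeriod (fun u => g (u + t) - g u) t) : IsPeriod g t := by
  intro u
  by_contra hne
  have hpos : 0 < ‖g (u + t) - g u‖ := norm_pos_iff.2 (sub_ne_zero.2 hne)
  -- A nonzero periodic difference makes `g` grow linearly along `t`.
  have hlin : ∀ n : ℕ, g (u + n • t) = g u + n * (g (u + t) - g u) := by
    intro n
    induction n with
    | zero => simp
    | succ n ih =>
      have h1 := h.nsmul n u
      rw [succ_nsmul, ← add_assoc, eq_add_of_sub_eq h1, ih]
      push_cast
      ring
  obtain ⟨n, hn⟩ := exists_nat_gt (2 * M / ‖g (u + t) - g u‖)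
  rw [div_lt_iff₀ hpos] at hn
  have h2 : (n : ℝ) * ‖g (u + t) - g u‖ = ‖g (u + n • t) - g u‖ := by
    rw [hlin n, add_sub_cancel_left, norm_mul, Complex.norm_natCast]
  have h3 := norm_sub_le (g (u + n • t)) (g u)
  linarith [hM u, hM (u + n • t)]

/-- The exponent is `-t` because multiplication by `x^v` replaces `u` by `u - v`. -/
theorem shiftAct_single_neg_sub_one (t : Cell d) (g : Cell d → ℂ) (u : Cell d) :
    shiftAct d ℂ (laurentMonomial (-t) 1 - 1) g u = g (u + t) - g u := by
  rw [map_sub, map_one, LinearMap.sub_apply, Pi.sub_apply, laurentMonomial, shiftAct_single,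
    sub_neg_eq_add, one_mul, Module.End.one_apply]

theorem isPeriod_iff_shiftAct_eq_zero {t : Cell d} {g : Cell d → ℂ} :
    IsPeriod g t ↔ shiftAct d ℂ (laurentMonomial (-t) 1 - 1) g = 0 := by
  rw [funext_iff]
  exact forall_congr' fun u => by rw [shiftAct_single_neg_sub_one, Pi.zero_apply, sub_eq_zero]

theorem exists_norm_iterate_difference_le {g : Cell d → ℂ} {M : ℝ} (hM : ∀ u, ‖g u‖ ≤ M)
    (t : Cell d) (n : ℕ) :
    ∃ M', ∀ u, ‖shiftAct d ℂ ((laurentMonomial (-t) 1 - 1) ^ n) g u‖ ≤ M' := by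
  induction n with
  | zero => exact ⟨M, fun u => by simpa using hM u⟩
  | succ n ih =>
    obtain ⟨M', hM'⟩ := ih
    refine ⟨M' + M', fun u => ?_⟩
    rw [pow_succ', map_mul, Module.End.mul_apply, shiftAct_single_neg_sub_one]
    exact (norm_sub_le _ _).trans (add_le_add (hM' _) (hM' _))

/-- A bounded function killed by a power of a difference operator is killed by the operator. -/
theorem isPeriod_of_mem_radical_annihilatorIdeal {g : Cell d → ℂ} {t : Cell d} {M : ℝ}
    (hM : ∀ u, ‖g u‖ ≤ M)
    (h : laurentMonomial (-t) 1 - 1 ∈ (annihilatorIdeal g).radical) : IsPeriod g t := by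
  obtain ⟨n, hn⟩ := h
  -- Exponents descend one at a time: the `m`-th iterated difference is bounded, so if its second
  -- difference vanishes, so does its first.
  have hstep : ∀ m, (laurentMonomial (-t) 1 - 1) ^ (m + 1) ∈ annihilatorIdeal g →
      laurentMonomial (-t) 1 - 1 ∈ annihilatorIdeal g := by
    intro m
    induction m with
    | zero => intro h; simpa using h
    | succ m ih =>
      intro h
      refine ih ?_
      obtain ⟨M', hM'⟩ := exists_norm_iterate_difference_le hM t m
      rw [mem_annihilatorIdeal, pow_succ', map_mul, Module.End.mul_apply,
        ← isPeriod_iff_shiftAct_eq_zero]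
      refine isPeriod_of_isPeriod_sub hM' ?_
      rw [mem_annihilatorIdeal, pow_succ', pow_succ', map_mul, map_mul, Module.End.mul_apply,
        Module.End.mul_apply, ← isPeriod_iff_shiftAct_eq_zero] at h
      intro u
      have h1 := h u
      rwa [shiftAct_single_neg_sub_one, shiftAct_single_neg_sub_one] at h1
  -- The exponent `n` may be zero, so it is first raised to `n + 1`.
  refine isPeriod_iff_shiftAct_eq_zero.2 (hstep n ?_)
  rw [pow_succ']
  exact Ideal.mul_mem_left _ _ hn

end Differences

/-! ### Sublattices of full rank -/

section Lattice

variable {d : ℕ}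

theorem Cell.toReal_add (u v : Cell d) : (u + v).toReal = u.toReal + v.toReal := by
  funext i
  simp [Cell.toReal]

theorem Cell.toReal_sub (u v : Cell d) : (u - v).toReal = u.toReal - v.toReal := by
  funext i
  simp [Cell.toReal]

/-- Integer vectors that span `ℝ^d` generate a subgroup of finite exponent in `ℤ^d`. -/
theorem exists_nsmul_mem_closure {V : Set (Cell d)}
    (hV : Submodule.span ℝ (Cell.toReal '' V) = ⊤) :
    ∃ N : ℕ, 0 < N ∧ ∀ t : Cell d, N • t ∈ AddSubgroup.closure V := by
  have hs : ⊤ ≤ Submodule.span ℝ (Cell.toReal '' V) := hV.ge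
  let b := Module.Basis.ofSpan hs
  let e := b.indexEquiv (Pi.basisFun ℝ (Fin d))
  have hb : ∀ i, ∃ v ∈ V, v.toReal = b.reindex e i := by
    intro i
    have h := Module.Basis.ofSpan_subset hs ⟨e.symm i, rfl⟩
    rwa [← b.reindex_apply e i] at h
  choose v hvV hv using hb
  let A : Matrix (Fin d) (Fin d) ℤ := Matrix.of v
  have hA : A.det ≠ 0 := by
    intro h0
    have hli : LinearIndependent ℝ (A.map (Int.cast : ℤ → ℝ)).row := by
      have h := (b.reindex e).linearIndependent
      rw [← funext hv] at h
      exact h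
    have h1 := (Matrix.isUnit_iff_isUnit_det _).1 (Matrix.linearIndependent_rows_iff_isUnit.1 hli)
    have h2 : (A.map (Int.cast : ℤ → ℝ)).det = ((A.det : ℤ) : ℝ) :=
      ((Int.castRingHom ℝ).map_det A).symm
    rw [h2, h0] at h1
    simp at h1
  refine ⟨A.det.natAbs, Int.natAbs_pos.2 hA, fun t => ?_⟩
  have h3 : A.det • t ∈ AddSubgroup.closure V := by
    -- Cramer's rule: the adjugate gives integer coefficients over the rows of `A`.
    have h4 : A.det • t = ∑ i, (Matrix.vecMul t A.adjugate) i • v i := by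
      have h5 : Matrix.vecMul (Matrix.vecMul t A.adjugate) A = A.det • t := by
        rw [Matrix.vecMul_vecMul, Matrix.adjugate_mul, Matrix.vecMul_smul, Matrix.vecMul_one]
      rw [← h5]
      funext j
      simp [Matrix.vecMul, dotProduct, A]
    rw [h4]
    exact sum_mem fun i _ => zsmul_mem (AddSubgroup.subset_closure (hvV i)) _
  rw [← natCast_zsmul, Int.natCast_natAbs]
  rcases abs_choice A.det with h | h
  · rwa [h]
  · rw [h, neg_smul]
    exact neg_mem h3

/-- A uniform exponent for all spanning subsets of a finite set of integer vectors. -/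
theorem exists_uniform_nsmul_mem_closure (V : Finset (Cell d)) :
    ∃ N : ℕ, 0 < N ∧ ∀ T ⊆ V, Submodule.span ℝ (Cell.toReal '' (T : Set (Cell d))) = ⊤ →
      ∀ t : Cell d, N • t ∈ AddSubgroup.closure (T : Set (Cell d)) := by
  have h : ∀ T : Finset (Cell d), ∃ N : ℕ, 0 < N ∧
      (Submodule.span ℝ (Cell.toReal '' (T : Set (Cell d))) = ⊤ →
        ∀ t : Cell d, N • t ∈ AddSubgroup.closure (T : Set (Cell d))) := by
    intro T
    by_cases hT : Submodule.span ℝ (Cell.toReal '' (T : Set (Cell d))) = ⊤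
    · obtain ⟨N, hN, h⟩ := exists_nsmul_mem_closure hT
      exact ⟨N, hN, fun _ => h⟩
    · exact ⟨1, one_pos, fun h => absurd h hT⟩
  choose N hN h using h
  -- The product over all subsets is a multiple of each individual exponent.
  refine ⟨∏ T ∈ V.powerset, N T, Finset.prod_pos fun T _ => hN T, fun T hTV hT t => ?_⟩
  rw [← Finset.prod_erase_mul _ _ (Finset.mem_powerset.2 hTV), mul_smul]
  exact nsmul_mem (h T hT t) _

theorem exists_hyperplane_of_ne_top {W : Submodule ℝ (Fin d → ℝ)} (hW : W ≠ ⊤) :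
    ∃ S, W ≤ S ∧ Module.finrank ℝ S + 1 = d := by
  obtain ⟨f, hf, hle⟩ := Submodule.exists_le_ker_of_lt_top W hW.lt_top
  exact ⟨LinearMap.ker f, hle, by
    simpa using Module.Dual.finrank_ker_add_one_of_ne_zero hf⟩

end Lattice

/-! ### Fibers -/

section Fibers

variable {d : ℕ} {S : Submodule ℝ (Fin d → ℝ)}

open Classical in
theorem coeff_restrictPoly (f : LaurentPoly d) (v : Cell d) :
    (restrictPoly S f).coeff v = if v.toReal ∈ S then f.coeff v else 0 := by
  simp only [restrictPoly, laurentMonomial, AddMonoidAlgebra.coeff_sum,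
    AddMonoidAlgebra.coeff_single, Finsupp.finsetSum_apply, Finsupp.single_apply,
    Finset.sum_ite_eq', Finset.mem_filter, laurentSupp, Finsupp.mem_support_iff]
  by_cases h : f.coeff v = 0 <;> simp [h]

theorem restrictPoly_add (f g : LaurentPoly d) :
    restrictPoly S (f + g) = restrictPoly S f + restrictPoly S g := by
  classical
  ext v
  simp only [coeff_restrictPoly, AddMonoidAlgebra.coeff_add, Finsupp.add_apply]
  split_ifs <;> simp

theorem restrictPoly_sum {ι : Type*} (s : Finset ι) (f : ι → LaurentPoly d) :
    restrictPoly S (∑ i ∈ s, f i) = ∑ i ∈ s, restrictPoly S (f i) := by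
  classical
  ext v
  simp only [coeff_restrictPoly, AddMonoidAlgebra.coeff_sum, Finsupp.finsetSum_apply]
  split_ifs <;> simp

open Classical in
theorem restrictPoly_laurentMonomial (u : Cell d) (a : ℂ) :
    restrictPoly S (laurentMonomial u a) = if u.toReal ∈ S then laurentMonomial u a else 0 := by
  ext v
  rw [coeff_restrictPoly]
  by_cases h : u = v
  · subst h
    split_ifs <;> simp
  · split_ifs <;> simp [laurentMonomial, h]

theorem laurentMonomial_mul (u v : Cell d) (a b : ℂ) :
    laurentMonomial u a * laurentMonomial v b = laurentMonomial (u + v) (a * b) :=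
  AddMonoidAlgebra.single_mul_single ..

theorem laurentMonomial_zero_one : laurentMonomial (0 : Cell d) 1 = 1 := rfl

theorem isUnit_laurentMonomial (u : Cell d) {a : ℂ} (ha : a ≠ 0) :
    IsUnit (laurentMonomial u a) := by
  refine IsUnit.of_mul_eq_one (laurentMonomial (-u) a⁻¹) ?_
  rw [laurentMonomial_mul, add_neg_cancel, mul_inv_cancel₀ ha, laurentMonomial_zero_one]

/-- The fiber of `f_D` through a translate of `S`, as a sum of monomials. -/
theorem restrictPoly_monomial_mul_charPoly [DecidablePred fun v : Cell d => v.toReal ∈ S]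
    (D : Finset (Cell d)) (u : Cell d) :
    restrictPoly S (laurentMonomial u 1 * charPoly D) =
      laurentMonomial u 1 * ∑ v ∈ D with (u + v).toReal ∈ S, laurentMonomial v 1 := by
  rw [charPoly, Finset.mul_sum, restrictPoly_sum, Finset.mul_sum, Finset.sum_filter]
  refine Finset.sum_congr rfl fun v _ => ?_
  rw [laurentMonomial_mul, mul_one, restrictPoly_laurentMonomial]
  congr

/-- If the fibers of `f` generate a monomial then a proper ideal omits some fiber of `f`. -/
theorem FibersGenerateMonomial.exists_restrictPoly_notMem {f : LaurentPoly d}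
    (h : FibersGenerateMonomial S f) {P : Ideal (LaurentPoly d)} (hP : P ≠ ⊤) :
    ∃ u, restrictPoly S (laurentMonomial u 1 * f) ∉ P := by
  by_contra! hcon
  obtain ⟨g, hg, v, a, ha, hga⟩ := h
  have hle : Ideal.span (fibersOf S f) ≤ P.comap (fiberRing S).subtype := by
    rw [Ideal.span_le]
    rintro g ⟨u, hu⟩
    change (g : LaurentPoly d) ∈ P
    rw [hu]
    exact hcon u
  have h1 : (g : LaurentPoly d) ∈ P := hle hg
  rw [hga] at h1
  exact hP (Ideal.eq_top_of_isUnit_mem _ h1 (isUnit_laurentMonomial v ha))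

end Fibers

/-! ### Periodicity from annihilation -/

section Annihilation

variable {d : ℕ}

open Polynomial in
/-- Power sums over all exponents vanish only if the coefficients of equal bases cancel. -/
theorem sum_filter_eq_zero_of_forall_pow {K ι : Type*} [CommRing K] [IsDomain K] [DecidableEq K]
    {s : Finset ι} {a y : ι → K} (h : ∀ j : ℕ, ∑ i ∈ s, a i * y i ^ j = 0) (b : K) :
    ∑ i ∈ s with y i = b, a i = 0 := by
  have hQ : ∀ Q : K[X], ∑ i ∈ s, a i * Q.eval (y i) = 0 := by
    intro Q
    simp only [eval_eq_sum_range, Finset.mul_sum]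
    rw [Finset.sum_comm]
    refine Finset.sum_eq_zero fun j _ => ?_
    rw [← mul_zero (Q.coeff j), ← h j, Finset.mul_sum]
    exact Finset.sum_congr rfl fun i _ => by ring
  -- The test polynomial vanishes at every base except `b`; its value at `b` is nonzero and cancels
  -- in the domain.
  have h1 := hQ (∏ z ∈ (s.image y).erase b, (X - C z))
  rw [← Finset.sum_filter_add_sum_filter_not s fun i => y i = b] at h1
  have h2 : ∑ i ∈ s with ¬ y i = b, a i * (∏ z ∈ (s.image y).erase b, (X - C z)).eval (y i) = 0 := by
    refine Finset.sum_eq_zero fun i hi => ?_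
    rw [Finset.mem_filter] at hi
    rw [eval_prod, Finset.prod_eq_zero (i := y i)
      (Finset.mem_erase.2 ⟨hi.2, Finset.mem_image_of_mem y hi.1⟩) (by simp), mul_zero]
  have h3 : ∑ i ∈ s with y i = b, a i * (∏ z ∈ (s.image y).erase b, (X - C z)).eval (y i) =
      (∑ i ∈ s with y i = b, a i) * (∏ z ∈ (s.image y).erase b, (X - C z)).eval b := by
    rw [Finset.sum_mul]
    refine Finset.sum_congr rfl fun i hi => ?_
    rw [(Finset.mem_filter.1 hi).2]
  rw [h2, h3, add_zero, mul_eq_zero] at h1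
  refine h1.resolve_right ?_
  rw [eval_prod]
  refine Finset.prod_ne_zero_iff.2 ?_
  intro z hz
  simpa [sub_eq_zero] using (Finset.ne_of_mem_erase hz).symm

/-- The exponents, multiplied by `r`, at which all monomials are congruent to `1`. -/
def unitExponents (P : Ideal (LaurentPoly d)) (r : ℕ) : AddSubgroup (Cell d) where
  carrier := {t | laurentMonomial ((r : ℤ) • t) 1 - 1 ∈ P}
  zero_mem' := by simp [laurentMonomial_zero_one]
  add_mem' := by
    intro s t hs ht
    have h := P.add_mem (P.mul_mem_left (laurentMonomial ((r : ℤ) • t) 1) hs) ht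
    rw [mul_sub, laurentMonomial_mul, mul_one, mul_one, sub_add_sub_cancel, ← smul_add,
      add_comm t s] at h
    exact h
  neg_mem' := by
    intro t ht
    have h := P.neg_mem (P.mul_mem_left (laurentMonomial (-((r : ℤ) • t)) 1) ht)
    rw [mul_sub, laurentMonomial_mul, mul_one, mul_one, neg_add_cancel, neg_sub,
      laurentMonomial_zero_one, ← smul_neg] at h
    exact h

theorem mem_unitExponents {P : Ideal (LaurentPoly d)} {r : ℕ} {t : Cell d} :
    t ∈ unitExponents P r ↔ laurentMonomial ((r : ℤ) • t) 1 - 1 ∈ P := Iff.rfl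

theorem sub_mem_unitExponents {P : Ideal (LaurentPoly d)} {r : ℕ} {u v : Cell d}
    (h : laurentMonomial ((r : ℤ) • u) 1 - laurentMonomial ((r : ℤ) • v) 1 ∈ P) :
    u - v ∈ unitExponents P r := by
  have h1 := P.mul_mem_left (laurentMonomial (-((r : ℤ) • v)) 1) h
  rwa [mul_sub, laurentMonomial_mul, laurentMonomial_mul, mul_one, neg_add_cancel,
    neg_add_eq_sub, ← smul_sub, laurentMonomial_zero_one] at h1

/-- A prime ideal containing the dilations of `f_D` identifies enough monomials of `f_D` to span
the whole space, if the fibers of `f_D` in hyperplanes generate monomials. -/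
theorem span_unitExponents_eq_top {D : Finset (Cell d)} {P : Ideal (LaurentPoly d)} [P.IsPrime]
    {r : ℕ} (hr : ∀ j : ℕ, (∑ u ∈ D, laurentMonomial (((1 + r * j : ℕ) : ℤ) • u) 1) ∈ P)
    (hD : ∀ S : Submodule ℝ (Fin d → ℝ), Module.finrank ℝ S + 1 = d →
      FibersGenerateMonomial S (charPoly D)) :
    Submodule.span ℝ (Cell.toReal ''
      {t | t ∈ unitExponents P r ∧ ∃ u ∈ D, ∃ v ∈ D, t = u - v}) = ⊤ := by
  classical
  by_contra hne
  obtain ⟨S, hle, hS⟩ := exists_hyperplane_of_ne_top hne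
  obtain ⟨w, hw⟩ := (hD S hS).exists_restrictPoly_notMem (Ideal.IsPrime.ne_top ‹P.IsPrime›)
  refine hw ?_
  rw [restrictPoly_monomial_mul_charPoly]
  refine P.mul_mem_left _ ?_
  let π := Ideal.Quotient.mk P
  let z : Cell d → LaurentPoly d ⧸ P := fun u => π (laurentMonomial u 1)
  let y : Cell d → LaurentPoly d ⧸ P := fun u => π (laurentMonomial ((r : ℤ) • u) 1)
  -- In the quotient the `j`-th dilation reads `∑ z u * y u ^ j = 0`.
  have hzy : ∀ b, ∑ u ∈ D with y u = b, z u = 0 := by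
    refine sum_filter_eq_zero_of_forall_pow fun j => ?_
    have h := Ideal.Quotient.eq_zero_iff_mem.2 (hr j)
    rw [map_sum] at h
    rw [← h]
    refine Finset.sum_congr rfl fun u _ => ?_
    simp only [z, y, π]
    rw [← map_pow, ← map_mul]
    congr 1
    unfold laurentMonomial
    rw [AddMonoidAlgebra.single_pow, AddMonoidAlgebra.single_mul_single, one_pow, one_mul]
    congr 1
    push_cast
    rw [add_smul, one_smul, mul_comm, mul_smul, natCast_zsmul _ j]
  rw [← Ideal.Quotient.eq_zero_iff_mem, map_sum,
    ← Finset.sum_fiberwise_of_maps_to (t := D.image y) (g := y)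
      fun u hu => Finset.mem_image_of_mem y (Finset.filter_subset _ _ hu)]
  refine Finset.sum_eq_zero fun b _ => ?_
  -- A class of equal `y` lies entirely inside or entirely outside the translate of `S`.
  have hmem : ∀ u ∈ D, ∀ v ∈ D, y u = y v → (w + u).toReal ∈ S → (w + v).toReal ∈ S := by
    intro u hu v hv huv hwu
    have h1 : v - u ∈ unitExponents P r :=
      sub_mem_unitExponents (Ideal.Quotient.eq.1 huv.symm)
    have h2 : (v - u).toReal ∈ S :=
      hle (Submodule.subset_span ⟨v - u, ⟨h1, v, hv, u, hu, rfl⟩, rfl⟩)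
    have h3 := S.add_mem hwu h2
    rwa [← Cell.toReal_add, add_add_sub_cancel] at h3
  by_cases hb : ∃ u ∈ D, y u = b ∧ (w + u).toReal ∈ S
  · obtain ⟨u, hu, rfl, hwu⟩ := hb
    rw [← hzy (y u), Finset.filter_filter]
    refine Finset.sum_congr (Finset.filter_congr fun v hv => ?_) fun _ _ => rfl
    exact ⟨fun h => h.2, fun h => ⟨hmem u hu v hv h.symm hwu, h⟩⟩
  · rw [Finset.filter_filter]
    refine Finset.sum_eq_zero fun u hu => ?_
    rw [Finset.mem_filter] at hu
    exact absurd ⟨u, hu.1, hu.2.2, hu.2.1⟩ hb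

/-- If the fibers of `f_D` in hyperplanes generate monomials then the finitely valued integer
functions annihilated by `f_D` have periods in all directions. -/
theorem IsConfiguration.exists_isPeriod_of_polyMul_eq_zero {D : Finset (Cell d)}
    (hD : ∀ S : Submodule ℝ (Fin d → ℝ), Module.finrank ℝ S + 1 = d →
      FibersGenerateMonomial S (charPoly D))
    {c : Cell d → ℤ} (hc : IsConfiguration c) (h : polyMul (charPoly D) c = 0) :
    ∃ N : ℕ, 0 < N ∧ ∀ t, IsPeriod c (N • t) := by
  classical
  have hsum : ∀ w, ∑ u ∈ D, c (w - u) = 0 := by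
    intro w
    have h1 := congrFun h w
    rw [polyMul_eq_shiftAct, charPoly] at h1
    unfold laurentMonomial at h1
    rw [shiftAct_sum_single, Pi.zero_apply] at h1
    exact_mod_cast h1
  obtain ⟨r, hr0, hr⟩ := hc.exists_dilate_mem_annihilatorIdeal hsum
  obtain ⟨M, hM⟩ := hc.exists_abs_le
  -- There are finitely many differences, so `N` can be fixed before the prime ideal varies.
  let V : Finset (Cell d) := (D ×ˢ D).image fun p => p.1 - p.2
  obtain ⟨N, hN0, hN⟩ := exists_uniform_nsmul_mem_closure V
  refine ⟨r * N, Nat.mul_pos hr0 hN0, fun t => ?_⟩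
  have hper : IsPeriod (fun u => (c u : ℂ)) ((r * N) • t) := by
    refine isPeriod_of_mem_radical_annihilatorIdeal (M := M) (fun u => ?_) ?_
    · rw [Complex.norm_intCast]
      exact_mod_cast hM u
    rw [Ideal.radical_eq_sInf, Ideal.mem_sInf]
    rintro P ⟨hle, hP⟩
    have hspan := span_unitExponents_eq_top (fun j => hle (hr j)) hD
    have hT : {t | t ∈ unitExponents P r ∧ ∃ u ∈ D, ∃ v ∈ D, t = u - v} =
        ((V.filter fun t => t ∈ unitExponents P r : Finset (Cell d)) : Set (Cell d)) := by
      ext t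
      simp only [V, Set.mem_ofPred_eq, Finset.coe_filter, Finset.mem_image, Finset.mem_product,
        Prod.exists]
      constructor
      · rintro ⟨h, u, hu, v, hv, rfl⟩
        exact ⟨⟨u, v, ⟨hu, hv⟩, rfl⟩, h⟩
      · rintro ⟨⟨u, v, ⟨hu, hv⟩, rfl⟩, h⟩
        exact ⟨h, u, hu, v, hv, rfl⟩
    rw [hT] at hspan
    have h1 := hN _ (Finset.filter_subset _ _) hspan (-t)
    have h2 : AddSubgroup.closure
        ((V.filter fun t => t ∈ unitExponents P r : Finset (Cell d)) : Set (Cell d)) ≤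
          unitExponents P r := by
      rw [AddSubgroup.closure_le]
      intro s hs
      exact (Finset.mem_filter.1 (Finset.mem_coe.1 hs)).2
    have h3 := mem_unitExponents.1 (h2 h1)
    rwa [natCast_zsmul, ← mul_smul, smul_neg] at h3
  exact fun u => Int.cast_injective (hper u)

/-- If the fibers of `f_D` in hyperplanes generate monomials then every configuration that has
`f_D` as a periodizer is strongly periodic. -/
theorem IsConfiguration.stronglyPeriodic_of_mem_periodizers {D : Finset (Cell d)}
    (hD : ∀ S : Submodule ℝ (Fin d → ℝ), Module.finrank ℝ S + 1 = d →
      FibersGenerateMonomial S (charPoly D))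
    {c : Cell d → ℤ} (hc : IsConfiguration c) (h : charPoly D ∈ periodizers c) :
    StronglyPeriodic c := by
  obtain ⟨t, hli, ht⟩ := h
  obtain ⟨M, hM⟩ := hc.exists_abs_le
  have key : ∀ i, ∃ N : ℕ, 0 < N ∧ IsPeriod c (N • t i) := by
    intro i
    have hconf : IsConfiguration fun u => c (u + t i) - c u := by
      refine Set.Finite.subset (hc.image2 (fun x y => x - y) hc) ?_
      rintro _ ⟨u, rfl⟩
      exact ⟨_, ⟨u + t i, rfl⟩, _, ⟨u, rfl⟩, rfl⟩
    have hann : polyMul (charPoly D) (fun u => c (u + t i) - c u) = 0 := by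
      funext w
      have h1 := ht i w
      simp only [polyMul] at h1 ⊢
      rw [Pi.zero_apply, ← sub_eq_zero.2 h1, ← Finset.sum_sub_distrib]
      refine Finset.sum_congr rfl fun v _ => ?_
      rw [sub_add_eq_add_sub]
      push_cast
      ring
    obtain ⟨N, hN0, hN⟩ := hconf.exists_isPeriod_of_polyMul_eq_zero hD hann
    refine ⟨N, hN0, ?_⟩
    have hper : IsPeriod (fun u => (c u : ℂ)) (N • t i) := by
      refine isPeriod_of_isPeriod_sub (M := M) (fun u => ?_) ?_
      · rw [Complex.norm_intCast]
        exact_mod_cast hM u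
      -- By telescoping, the period of the first difference passes to the difference along `k • t
      -- i`; then `k = N` is taken.
      have hk : ∀ k : ℕ, IsPeriod (fun u => c (u + k • t i) - c u) (N • t i) := by
        intro k
        induction k with
        | zero => intro u; simp
        | succ k ih =>
          intro u
          have h1 := ih u
          have h2 := hN (t i) (u + k • t i)
          simp only [succ_nsmul, ← add_assoc, add_right_comm _ (N • t i)] at h1 h2 ⊢
          linarith
      intro u
      have h1 := congrArg (Int.cast : ℤ → ℂ) (hk N u)
      simpa only [Int.cast_sub] using h1
    exact fun u => Int.cast_injective (hper u)
  choose N hN0 hN using key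
  refine ⟨fun i => N i • t i, ?_, hN⟩
  have h1 := hli.units_smul fun i => Units.mk0 (N i : ℝ) (by exact_mod_cast (hN0 i).ne')
  convert h1 using 2 with i
  funext j
  simp [Cell.toReal, Units.smul_def]

end Annihilation

/-! ### A maximal ideal criterion for fibers to generate a monomial -/

section Retraction

variable {d : ℕ} {S : Submodule ℝ (Fin d → ℝ)}

theorem isFiber_restrictPoly (f : LaurentPoly d) : IsFiber S (restrictPoly S f) := by
  classical
  intro v hv
  rw [laurentSupp, Finsupp.mem_support_iff, coeff_restrictPoly] at hv
  by_contra h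
  exact hv (if_neg h)

theorem sum_laurentMonomial_coeff (f : LaurentPoly d) :
    ∑ v ∈ laurentSupp f, laurentMonomial v (f.coeff v) = f := by
  ext w
  simp only [laurentMonomial, AddMonoidAlgebra.coeff_sum, AddMonoidAlgebra.coeff_single,
    Finsupp.finsetSum_apply, Finsupp.single_apply, Finset.sum_ite_eq', laurentSupp,
    Finsupp.mem_support_iff]
  by_cases h : f.coeff w = 0 <;> simp [h]

/-- The restriction to `S` is linear over the ring of `S`-fibers. -/
theorem restrictPoly_mul_of_isFiber (h : LaurentPoly d) {b : LaurentPoly d} (hb : IsFiber S b) :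
    restrictPoly S (h * b) = restrictPoly S h * b := by
  classical
  conv_lhs => rw [← sum_laurentMonomial_coeff h, ← sum_laurentMonomial_coeff b]
  conv_rhs => rw [← sum_laurentMonomial_coeff h]
  rw [Finset.sum_mul, restrictPoly_sum, restrictPoly_sum, Finset.sum_mul]
  refine Finset.sum_congr rfl fun u _ => ?_
  rw [Finset.mul_sum, restrictPoly_sum]
  conv_rhs => rw [← sum_laurentMonomial_coeff b, Finset.mul_sum]
  refine Finset.sum_congr rfl fun v hv => ?_
  rw [laurentMonomial_mul, restrictPoly_laurentMonomial, restrictPoly_laurentMonomial,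
    Cell.toReal_add, S.add_mem_iff_left (hb v hv), ite_mul, zero_mul, laurentMonomial_mul]

/-- The fibers of `f` generate a monomial if no maximal ideal of the Laurent polynomial ring
contains them all. -/
theorem fibersGenerateMonomial_of_forall_isMaximal {f : LaurentPoly d}
    (h : ∀ P : Ideal (LaurentPoly d), P.IsMaximal →
      ∃ u, restrictPoly S (laurentMonomial u 1 * f) ∉ P) :
    FibersGenerateMonomial S f := by
  let F : Set (LaurentPoly d) := Set.range fun u => restrictPoly S (laurentMonomial u 1 * f)
  have htop : Ideal.span F = ⊤ := by
    by_contra hne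
    obtain ⟨P, hP, hle⟩ := Ideal.exists_le_maximal _ hne
    obtain ⟨u, hu⟩ := h P hP
    exact hu (hle (Ideal.subset_span ⟨u, rfl⟩))
  let ρ : LaurentPoly d → fiberRing S := fun g => ⟨restrictPoly S g, isFiber_restrictPoly g⟩
  -- The arbitrary multiplier `k` absorbs scalars of the full ring, over which restriction is not
  -- linear.
  have key : ∀ g ∈ Ideal.span F, ∀ k, ρ (k * g) ∈ Ideal.span (fibersOf S f) := by
    intro g hg
    induction hg using Submodule.span_induction with
    | mem g hg =>
      obtain ⟨u, rfl⟩ := hg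
      intro k
      have h1 : ρ (k * restrictPoly S (laurentMonomial u 1 * f)) =
          ρ k * ρ (laurentMonomial u 1 * f) :=
        Subtype.ext (restrictPoly_mul_of_isFiber k (isFiber_restrictPoly _))
      simp only [h1]
      exact Ideal.mul_mem_left _ _ (Ideal.subset_span ⟨u, rfl⟩)
    | zero =>
      intro k
      have h1 : ρ (k * 0) = 0 := Subtype.ext (by simp [ρ, restrictPoly, laurentSupp])
      rw [h1]
      exact zero_mem _
    | add x y _ _ hx hy =>
      intro k
      have h1 : ρ (k * (x + y)) = ρ (k * x) + ρ (k * y) :=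
        Subtype.ext (by simp only [ρ, mul_add, restrictPoly_add]; rfl)
      rw [h1]
      exact add_mem (hx k) (hy k)
    | smul a x _ hx =>
      intro k
      rw [smul_eq_mul, ← mul_assoc]
      exact hx (k * a)
  refine ⟨ρ (1 * 1), key 1 (htop ▸ Submodule.mem_top) 1, 0, 1, one_ne_zero, ?_⟩
  have h0 : (0 : Cell d).toReal ∈ S := by
    have h1 : (0 : Cell d).toReal = 0 := by
      funext i
      simp [Cell.toReal]
    rw [h1]
    exact S.zero_mem
  classical
  change restrictPoly S (1 * 1) = _
  rw [mul_one, ← laurentMonomial_zero_one, restrictPoly_laurentMonomial, if_pos h0]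

end Retraction

/-! ### Characters vanishing on the level sets of a linear form -/

section Levels

variable {d : ℕ} {K : Type*} [Field K]

open Classical in
/-- The monomials in `D` with values taken at `z` sum to zero over each level set of the linear
form with coefficients `ℓ`. -/
def VanishesOnLevels (D : Finset (Cell d)) (ℓ : Fin d → ℝ) (z : Fin d → K) : Prop :=
  ∀ s : ℝ, ∑ u ∈ D with ∑ i, ℓ i * u i = s, ∏ i, z i ^ u i = 0

theorem VanishesOnLevels.perm {r : ℕ} {ℓ : Fin d → ℝ} {z : Fin d → K}
    (h : VanishesOnLevels (leeSphere r d) ℓ z) (σ : Equiv.Perm (Fin d)) :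
    VanishesOnLevels (leeSphere r d) (ℓ ∘ σ) (z ∘ σ) := by
  intro s
  rw [← h s]
  refine Finset.sum_equiv (Equiv.arrowCongr σ (Equiv.refl ℤ)) (fun u => ?_) fun u _ => ?_
  · simp only [Finset.mem_filter, mem_leeSphere, Equiv.arrowCongr_apply, Function.comp_apply,
      Equiv.refl_apply]
    rw [← Equiv.sum_comp σ fun i => |u (σ.symm i)|, ← Equiv.sum_comp σ fun i => ℓ i * u (σ.symm i)]
    simp only [Equiv.symm_apply_apply]
  · simp only [Equiv.arrowCongr_apply, Function.comp_apply, Equiv.refl_apply]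
    rw [← Equiv.prod_comp σ fun i => z i ^ u (σ.symm i)]
    simp only [Equiv.symm_apply_apply]

/-- Reflecting a coordinate preserves the Lee sphere and inverts `z i`; with `perm`, this allows a
sorted nonnegative form. -/
theorem VanishesOnLevels.units_zpow {r : ℕ} {ℓ : Fin d → ℝ} {z : Fin d → K}
    (h : VanishesOnLevels (leeSphere r d) ℓ z) (ε : Fin d → ℤˣ) :
    VanishesOnLevels (leeSphere r d) (fun i => ((ε i : ℤ) : ℝ) * ℓ i)
      (fun i => z i ^ (ε i : ℤ)) := by
  intro s
  rw [← h s]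
  have hinv : Function.Involutive fun (u : Cell d) i => (ε i : ℤ) * u i := by
    intro u
    funext i
    change (ε i : ℤ) * ((ε i : ℤ) * u i) = u i
    rw [← mul_assoc, ← Units.val_mul, Int.units_mul_self, Units.val_one, one_mul]
  refine Finset.sum_equiv hinv.toPerm (fun u => ?_) fun u _ => ?_
  · simp only [Finset.mem_filter, mem_leeSphere, Function.Involutive.coe_toPerm, abs_mul,
      Int.isUnit_iff_abs_eq.1 (ε _).isUnit, one_mul, Int.cast_mul, mul_left_comm, mul_assoc]
  · simp only [Function.Involutive.coe_toPerm, zpow_mul]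

theorem leeSphere_two_three : leeSphere 2 3 =
    {![0, 0, 0], ![1, 0, 0], ![-1, 0, 0], ![0, 1, 0], ![0, -1, 0], ![0, 0, 1], ![0, 0, -1],
      ![2, 0, 0], ![-2, 0, 0], ![0, 2, 0], ![0, -2, 0], ![0, 0, 2], ![0, 0, -2],
      ![1, 1, 0], ![1, -1, 0], ![-1, 1, 0], ![-1, -1, 0],
      ![1, 0, 1], ![1, 0, -1], ![-1, 0, 1], ![-1, 0, -1],
      ![0, 1, 1], ![0, 1, -1], ![0, -1, 1], ![0, -1, -1]} := by
  decide +kernel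

theorem VanishesOnLevels.sum_eq_zero {D : Finset (Cell d)} {ℓ : Fin d → ℝ} {z : Fin d → K}
    (h : VanishesOnLevels D ℓ z) (s : ℝ) (T : Finset (Cell d)) (hT : T ⊆ D)
    (hs : ∀ u ∈ D, ∑ i, ℓ i * u i = s ↔ u ∈ T) : ∑ u ∈ T, ∏ i, z i ^ u i = 0 := by
  classical
  rw [← h s, Finset.filter_congr hs, Finset.filter_mem_eq_inter, Finset.inter_eq_right.2 hT]

theorem VanishesOnLevels.vertex {ℓ : Fin 3 → ℝ} {z : Fin 3 → K}
    (h : VanishesOnLevels (leeSphere 2 3) ℓ z) (h0 : 0 ≤ ℓ 0) (h01 : ℓ 0 ≤ ℓ 1)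
    (h12 : ℓ 1 < ℓ 2) :
    z 2 ^ 2 = 0 := by
  have e := h.sum_eq_zero (2 * ℓ 2)
    {![0, 0, 2]}
    (by decide +kernel) (by
    intro u hu
    rw [leeSphere_two_three] at hu
    fin_cases hu <;> simp [Fin.sum_univ_three] <;> grind)
  simpa [Fin.prod_univ_three, add_assoc] using e

theorem VanishesOnLevels.edge {ℓ : Fin 3 → ℝ} {z : Fin 3 → K}
    (h : VanishesOnLevels (leeSphere 2 3) ℓ z) (h0 : 0 ≤ ℓ 0) (h02 : ℓ 0 < ℓ 2)
    (h12 : ℓ 1 = ℓ 2) :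
    z 1 ^ 2 + z 1 * z 2 + z 2 ^ 2 = 0 := by
  have e := h.sum_eq_zero (2 * ℓ 2)
    {![0, 2, 0], ![0, 1, 1], ![0, 0, 2]}
    (by decide +kernel) (by
    intro u hu
    rw [leeSphere_two_three] at hu
    fin_cases hu <;> simp [Fin.sum_univ_three] <;> grind)
  simpa [Fin.prod_univ_three, add_assoc] using e

/-- When `2 * ℓ 0 = ℓ 2`, this level also contains `![2, 0, 0]`; `outer_edge` then takes its place.
-/
theorem VanishesOnLevels.inner_edge {ℓ : Fin 3 → ℝ} {z : Fin 3 → K}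
    (h : VanishesOnLevels (leeSphere 2 3) ℓ z) (h0 : 0 < ℓ 0) (h02 : ℓ 0 < ℓ 2)
    (h12 : ℓ 1 = ℓ 2) (hne : 2 * ℓ 0 ≠ ℓ 2) :
    z 1 + z 2 = 0 := by
  have e := h.sum_eq_zero (ℓ 2)
    {![0, 1, 0], ![0, 0, 1]}
    (by decide +kernel) (by
    intro u hu
    rw [leeSphere_two_three] at hu
    fin_cases hu <;> simp [Fin.sum_univ_three] <;> grind)
  simpa [Fin.prod_univ_three, add_assoc] using e

theorem VanishesOnLevels.outer_edge {ℓ : Fin 3 → ℝ} {z : Fin 3 → K}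
    (h : VanishesOnLevels (leeSphere 2 3) ℓ z) (h0 : 0 < ℓ 0)
    (h12 : ℓ 1 = ℓ 2) (heq : 2 * ℓ 0 = ℓ 2) :
    z 0 * z 1 + z 0 * z 2 = 0 := by
  have e := h.sum_eq_zero (3 * ℓ 0)
    {![1, 1, 0], ![1, 0, 1]}
    (by decide +kernel) (by
    intro u hu
    rw [leeSphere_two_three] at hu
    fin_cases hu <;> simp [Fin.sum_univ_three] <;> grind)
  simpa [Fin.prod_univ_three, add_assoc] using e

theorem VanishesOnLevels.strip {ℓ : Fin 3 → ℝ} {z : Fin 3 → K}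
    (h : VanishesOnLevels (leeSphere 2 3) ℓ z) (h0 : ℓ 0 = 0) (h2 : 0 < ℓ 2)
    (h12 : ℓ 1 = ℓ 2) :
    z 1 + z 2 + z 0 * z 1 + z 0 * z 2 + (z 0)⁻¹ * z 1 + (z 0)⁻¹ * z 2 = 0 := by
  have e := h.sum_eq_zero (ℓ 2)
    {![0, 1, 0], ![0, 0, 1], ![1, 1, 0], ![1, 0, 1], ![-1, 1, 0], ![-1, 0, 1]}
    (by decide +kernel) (by
    intro u hu
    rw [leeSphere_two_three] at hu
    fin_cases hu <;> simp [Fin.sum_univ_three] <;> grind)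
  simpa [Fin.prod_univ_three, add_assoc] using e

theorem VanishesOnLevels.central_rhombus {ℓ : Fin 3 → ℝ} {z : Fin 3 → K}
    (h : VanishesOnLevels (leeSphere 2 3) ℓ z) (h0 : ℓ 0 = 0) (h2 : 0 < ℓ 2)
    (h12 : ℓ 1 = ℓ 2) :
    1 + z 1 * (z 2)⁻¹ + (z 1)⁻¹ * z 2 + z 0 + (z 0)⁻¹ + z 0 ^ 2 + (z 0 ^ 2)⁻¹ = 0 := by
  have e := h.sum_eq_zero (0)
    {![0, 0, 0], ![0, 1, -1], ![0, -1, 1], ![1, 0, 0], ![-1, 0, 0], ![2, 0, 0], ![-2, 0, 0]}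
    (by decide +kernel) (by
    intro u hu
    rw [leeSphere_two_three] at hu
    fin_cases hu <;> simp [Fin.sum_univ_three] <;> grind)
  have h2 : z 0 ^ (-2 : ℤ) = (z 0 ^ 2)⁻¹ := by rw [zpow_neg, zpow_ofNat]
  simpa [Fin.prod_univ_three, add_assoc, h2] using e

theorem VanishesOnLevels.inner_face {ℓ : Fin 3 → ℝ} {z : Fin 3 → K}
    (h : VanishesOnLevels (leeSphere 2 3) ℓ z) (h2 : 0 < ℓ 2) (h02 : ℓ 0 = ℓ 2)
    (h12 : ℓ 1 = ℓ 2) :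
    z 0 + z 1 + z 2 = 0 := by
  have e := h.sum_eq_zero (ℓ 2)
    {![1, 0, 0], ![0, 1, 0], ![0, 0, 1]}
    (by decide +kernel) (by
    intro u hu
    rw [leeSphere_two_three] at hu
    fin_cases hu <;> simp [Fin.sum_univ_three] <;> grind)
  simpa [Fin.prod_univ_three, add_assoc] using e

theorem VanishesOnLevels.central_hexagon {ℓ : Fin 3 → ℝ} {z : Fin 3 → K}
    (h : VanishesOnLevels (leeSphere 2 3) ℓ z) (h2 : 0 < ℓ 2) (h02 : ℓ 0 = ℓ 2)
    (h12 : ℓ 1 = ℓ 2) :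
    1 + z 0 * (z 1)⁻¹ + (z 0)⁻¹ * z 1 + z 0 * (z 2)⁻¹ + (z 0)⁻¹ * z 2 + z 1 * (z 2)⁻¹ +
      (z 1)⁻¹ * z 2 = 0 := by
  have e := h.sum_eq_zero (0)
    {![0, 0, 0], ![1, -1, 0], ![-1, 1, 0], ![1, 0, -1], ![-1, 0, 1], ![0, 1, -1], ![0, -1, 1]}
    (by decide +kernel) (by
    intro u hu
    rw [leeSphere_two_three] at hu
    fin_cases hu <;> simp [Fin.sum_univ_three] <;> grind)
  simpa [Fin.prod_univ_three, add_assoc] using e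

/-- Nonzero numbers do not annihilate all level sets of the Lee sphere of radius two, for a
linear form with sorted nonnegative coefficients. -/
theorem not_vanishesOnLevels_of_sorted [CharZero K] {ℓ : Fin 3 → ℝ} {z : Fin 3 → K}
    (hz : ∀ i, z i ≠ 0) (h0 : 0 ≤ ℓ 0) (h01 : ℓ 0 ≤ ℓ 1) (h12 : ℓ 1 ≤ ℓ 2) (h2 : 0 < ℓ 2) :
    ¬ VanishesOnLevels (leeSphere 2 3) ℓ z := by
  intro h
  have hx := hz 0
  have hy := hz 1
  have hw := hz 2
  rcases h12.lt_or_eq with h12 | h12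
  · exact pow_ne_zero 2 hw (h.vertex h0 h01 h12)
  rcases (h01.trans h12.le).lt_or_eq with h02 | h02
  · have e1 := h.edge h0 h02 h12
    rcases h0.lt_or_eq with h0 | h0
    · have e2 : z 1 + z 2 = 0 := by
        by_cases hne : 2 * ℓ 0 = ℓ 2
        · have e := h.outer_edge h0 h12 hne
          rw [← mul_add] at e
          exact (mul_eq_zero.1 e).resolve_left hx
        · exact h.inner_edge h0 h02 h12 hne
      -- Substituting `z 1 = -z 2` into the edge relation leaves `z 2 ^ 2 = 0`.
      exact pow_ne_zero 2 hw (by linear_combination e1 - z 1 * e2)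
    · have e2 := h.strip h0.symm h2 h12
      have e3 := h.central_rhombus h0.symm h2 h12
      field_simp at e2 e3
      -- The strip relation factors through `z 1 + z 2`, whose square is `z 1 * z 2` by the edge
      -- relation.
      have e4 : z 1 * z 2 * (z 0 ^ 2 + z 0 + 1) = 0 := by
        linear_combination (z 1 + z 2) * e2 - (z 0 ^ 2 + z 0 + 1) * e1
      have e5 : z 0 ^ 2 + z 0 + 1 = 0 :=
        (mul_eq_zero.1 e4).resolve_left (mul_ne_zero hy hw)
      -- Both `z 0` and `z 1 / z 2` are now primitive cube roots of unity, so the central level sums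
      -- to `1 - 1 - 1 - 1 = -2`.
      have e6 : 2 * (z 1 * z 2 * z 0 ^ 2) = 0 := by
        linear_combination z 0 ^ 2 * e1 + z 1 * z 2 * (z 0 ^ 2 + 1) * e5 - e3
      simp [hx, hy, hw] at e6
  · have e2 := h.inner_face h2 h02 h12
    have e3 := h.central_hexagon h2 h02 h12
    field_simp at e3
    -- The hexagon sum is `(∑ z_i)(∑ z_i⁻¹) - 2`, and the first factor vanishes.
    have e4 : 2 * (z 0 * z 1 * z 2) = 0 := by
      linear_combination (z 0 * z 1 + z 1 * z 2 + z 0 * z 2) * e2 - e3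
    simp [hx, hy, hw] at e4

/-- Nonzero numbers do not annihilate all level sets of the Lee sphere of radius two, for a nonzero
linear form. -/
theorem not_vanishesOnLevels [CharZero K] {ℓ : Fin 3 → ℝ} (hℓ : ℓ ≠ 0) {z : Fin 3 → K}
    (hz : ∀ i, z i ≠ 0) : ¬ VanishesOnLevels (leeSphere 2 3) ℓ z := by
  intro h
  let ε : Fin 3 → ℤˣ := fun i => if 0 ≤ ℓ i then 1 else -1
  have hε : ∀ i, ((ε i : ℤ) : ℝ) * ℓ i = |ℓ i| := by
    intro i
    simp only [ε]
    split_ifs with hi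
    · simp [abs_of_nonneg hi]
    · simp [abs_of_neg (not_le.1 hi)]
  have h1 := h.units_zpow ε
  simp only [hε] at h1
  let σ := Tuple.sort fun i => |ℓ i|
  have hmono : Monotone ((fun i => |ℓ i|) ∘ σ) := Tuple.monotone_sort _
  refine not_vanishesOnLevels_of_sorted (fun i => zpow_ne_zero _ (hz (σ i))) (abs_nonneg _)
    (hmono (by decide)) (hmono (by decide)) ?_ (h1.perm σ)
  by_contra hle
  refine hℓ (funext fun i => abs_nonpos_iff.1 ?_)
  have h2 := hmono (Fin.le_last (σ.symm i))
  simp only [Function.comp_apply, Equiv.apply_symm_apply] at h2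
  exact h2.trans (not_lt.1 hle)

end Levels

/-! ### The Lee sphere of radius two -/

theorem map_laurentMonomial_eq_prod {d : ℕ} {K : Type*} [Field K] (π : LaurentPoly d →+* K)
    (u : Cell d) :
    π (laurentMonomial u 1) = ∏ i, π (laurentMonomial (Pi.single i 1) 1) ^ u i := by
  let φ : Multiplicative (Cell d) →* K := π.toMonoidHom.comp (AddMonoidAlgebra.of ℂ (Cell d))
  have h : u = ∑ i, u i • (Pi.single i 1 : Cell d) := by
    funext j
    simp [Finset.sum_apply, Pi.single_apply]
  have h1 : ∀ v, φ (Multiplicative.ofAdd v) = π (laurentMonomial v 1) := fun v => rfl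
  rw [← h1]
  conv_lhs => rw [h, ofAdd_sum, map_prod]
  refine Finset.prod_congr rfl fun i _ => ?_
  rw [ofAdd_zsmul, ← h1]
  -- The target is only a group with zero, so compatibility with inverses is checked by hand.
  refine map_zpow' φ (fun x => eq_inv_of_mul_eq_one_left ?_) _ _
  rw [← map_mul, inv_mul_cancel, map_one]

/-- The fibers of the Lee sphere of radius two in every plane generate a monomial. -/
theorem fibersGenerateMonomial_leeSphere_two_three {S : Submodule ℝ (Fin 3 → ℝ)}
    (hS : Module.finrank ℝ S = 2) : FibersGenerateMonomial S (charPoly (leeSphere 2 3)) := by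
  classical
  have hne : S ≠ ⊤ := by
    rintro rfl
    simp at hS
  obtain ⟨f, hf, hle⟩ := Submodule.exists_le_ker_of_lt_top S hne.lt_top
  have hker : S = LinearMap.ker f := by
    refine Submodule.eq_of_le_of_finrank_eq hle ?_
    have h := Module.Dual.finrank_ker_add_one_of_ne_zero hf
    simp only [Module.finrank_fintype_fun_eq_card, Fintype.card_fin] at h
    omega
  let ℓ : Fin 3 → ℝ := fun i => f (Pi.single i 1)
  have hfℓ : ∀ v, f v = ∑ i, ℓ i * v i := by
    intro v
    rw [LinearMap.pi_apply_eq_sum_univ f v]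
    refine Finset.sum_congr rfl fun i _ => ?_
    have h : (Pi.single i 1 : Fin 3 → ℝ) = fun j => if i = j then 1 else 0 := by
      funext j
      simp [Pi.single_apply, eq_comm]
    rw [← h, smul_eq_mul, mul_comm]
  have hℓ : ℓ ≠ 0 := by
    intro h0
    refine hf (LinearMap.ext fun v => ?_)
    simp [hfℓ, h0]
  refine fibersGenerateMonomial_of_forall_isMaximal fun P hP => ?_
  by_contra! hcon
  let := Ideal.Quotient.field P
  let π := Ideal.Quotient.mk P
  -- Characteristic zero suffices, so the residue field need not be identified with `ℂ`.
  have hchar : CharZero (LaurentPoly 3 ⧸ P) :=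
    charZero_of_injective_algebraMap (algebraMap ℂ (LaurentPoly 3 ⧸ P)).injective
  refine not_vanishesOnLevels (K := LaurentPoly 3 ⧸ P) hℓ
    (z := fun i => π (laurentMonomial (Pi.single i 1) 1))
    (fun i => ((isUnit_laurentMonomial _ one_ne_zero).map π).ne_zero) fun s => ?_
  simp only [← map_laurentMonomial_eq_prod]
  by_cases hs : ∃ w ∈ leeSphere 2 3, ∑ i, ℓ i * (w i : ℝ) = s
  · obtain ⟨w, -, rfl⟩ := hs
    -- Translation by `-w` brings the level of `w` onto the kernel `S`.
    have h1 := hcon (-w)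
    rw [restrictPoly_monomial_mul_charPoly, Ideal.unit_mul_mem_iff_mem P
      (isUnit_laurentMonomial _ one_ne_zero), ← Ideal.Quotient.eq_zero_iff_mem, map_sum] at h1
    rw [← h1]
    refine Finset.sum_congr (Finset.filter_congr fun v _ => ?_) fun _ _ => rfl
    rw [hker, LinearMap.mem_ker, neg_add_eq_sub, Cell.toReal_sub, map_sub, sub_eq_zero, hfℓ, hfℓ]
    rfl
  · refine Finset.sum_eq_zero fun u hu => ?_
    rw [Finset.mem_filter] at hu
    exact absurd ⟨u, hu⟩ hs

end

theorem mainTheorem5 :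
    (∀ S : Submodule ℝ (Fin 3 → ℝ), Module.finrank ℝ S = 2 →
      FibersGenerateMonomial S (charPoly (leeSphere 2 3))) ∧
    (∀ c : Cell 3 → ℤ, IsConfiguration c →
      charPoly (leeSphere 2 3) ∈ periodizers c → StronglyPeriodic c) ∧
    (∀ c : Cell 3 → ℤ, IsTiling (leeSphere 2 3) c → StronglyPeriodic c) := by
  have h2 : ∀ c : Cell 3 → ℤ, IsConfiguration c →
      charPoly (leeSphere 2 3) ∈ periodizers c → StronglyPeriodic c := fun c hc h =>
    hc.stronglyPeriodic_of_mem_periodizers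
      (fun S hS => fibersGenerateMonomial_leeSphere_two_three (Nat.succ_injective hS)) h
  refine ⟨fun S hS => fibersGenerateMonomial_leeSphere_two_three hS, h2, fun c hc => h2 c ?_ ?_⟩
  · refine (Set.toFinite {0, 1}).subset ?_
    rintro _ ⟨u, rfl⟩
    exact hc.1 u
  · refine ⟨fun i => Pi.single i 1, ?_, fun i u => by rw [hc.2]⟩
    have h := (Pi.basisFun ℝ (Fin 3)).linearIndependent
    convert h using 2 with i
    funext j
    by_cases hij : j = i <;> simp [Cell.toReal, hij]
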